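/- Let $X=\{X_s\}_{s\ge 0}$ be a one-dimensional symmetric Lévy process started at $0$, with (real) characteristic exponent $\Psi:\mathbb{R}\to\mathbb{R}$, i.e. $\mathbb{E}[e^{-ixX_s}]=e^{-s\Psi(x)}$ for all $s\ge 0$, $x\in\mathbb{R}$. Assume that $\Psi(x)=\Psi(|x|)\ge 0$, that $\Psi$ is non-decreasing on $[0,\infty)$, and that for some $\ell\in(0,\infty)$ $$\lim_{x\to 0+}\frac{\Psi(x)}{x^2}=\ell,\qquad \lim_{x\to\infty}\frac{\Psi(x)}{\ln(|x|+1)}=\infty,\qquad \int_{\mathbb{R}}\frac{dx}{1+\Psi(x)}<\infty .$$ Let $f:\mathbb{R}\to\mathbb{R}$ satisfy $f\in L^1(\mathbb{R})\cap L^\infty(\mathbb{R})$, and suppose that its Fourier transform $\widehat f(\xi)=\int_{\mathbb{R}}e^{-i\xi x}f(x)\,dx$ satisfies $\widehat f\in L^1(\mathbb{R})$ and $$\int_{\mathbb{R}}\frac{|\widehat f(x)-\widehat f(0)|}{x^2}\,dx<\infty .$$ Let $\{a(n)\}_{n\in\mathbb{N}}$ be an increasing sequence (not necessarily strictly) of positive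 numbers with $a(n)\to\infty$, and let $t>0$. Then for every $n$ the integral $\int_0^{t^2a(n)^2}f(X_s)\,ds$ exists almost surely and defines a square-integrable random variable, and $$\lim_{n\to\infty}\mathbb{E}\left[\frac{1}{a(n)}\int_0^{t^2a(n)^2}f(X_s)\,ds\right]=\left(\int_{\mathbb{R}}f(x)\,dx\right)\frac{t}{\sqrt{\pi\ell}},$$ $$\lim_{n\to\infty}\mathbb{E}\left[\left(\frac{1}{a(n)}\int_0^{t^2a(n)^2}f(X_s)\,ds\right)^2\right]=\left(\int_{\mathbb{R}}f(x)\,dx\right)^2\frac{t^2}{2\ell}.$$ -/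

import Mathlib

open MeasureTheory ProbabilityTheory Filter Topology
open scoped NNReal ENNReal

namespace LevyFunctional

/-- A real-valued Lévy process started at zero: independent and stationary increments,
almost surely càdlàg paths (stochastic continuity follows from these properties). -/
structure IsLevyProcess {Ω : Type*} [MeasurableSpace Ω] (X : ℝ≥0 → Ω → ℝ) (P : Measure Ω) :
    Prop where
  measurable : ∀ t, Measurable (X t)
  start_zero : ∀ᵐ ω ∂P, X 0 ω = 0
  indep_increments : HasIndepIncrements X P
  stationary_increments : ∀ s h : ℝ≥0,
    IdentDistrib (fun ω => X (s + h) ω - X s ω) (X h) P P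
  cadlag : ∀ᵐ ω ∂P, ∀ t : ℝ≥0,
    ContinuousWithinAt (fun s => X s ω) (Set.Ici t) t ∧
      ∃ l : ℝ, Tendsto (fun s => X s ω) (𝓝[<] t) (𝓝 l)

/-- The process is symmetric: `X t` and `-X t` have the same law for every `t`. -/
def IsSymmetricProcess {Ω : Type*} [MeasurableSpace Ω] (X : ℝ≥0 → Ω → ℝ) (P : Measure Ω) :
    Prop :=
  ∀ t, IdentDistrib (X t) (fun ω => -X t ω) P P

/-- `Ψ` is the characteristic exponent of `X`: `E[exp (-i x X_s)] = exp (-s Ψ(x))`. -/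
def HasCharExponent {Ω : Type*} [MeasurableSpace Ω] (X : ℝ≥0 → Ω → ℝ) (P : Measure Ω)
    (Ψ : ℝ → ℝ) : Prop :=
  ∀ (s : ℝ≥0) (x : ℝ),
    ∫ ω, Complex.exp (-Complex.I * (x : ℂ) * (X s ω : ℂ)) ∂P
      = Complex.exp (-((s : ℝ) : ℂ) * (Ψ x : ℂ))

/-- The standing conditions on the characteristic exponent, with constant `ℓ`. -/
structure IsAdmissibleExponent (Ψ : ℝ → ℝ) (ℓ : ℝ) : Prop where
  even : ∀ x, Ψ x = Ψ |x|
  nonneg : ∀ x, 0 ≤ Ψ x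
  monotoneOn : MonotoneOn Ψ (Set.Ici 0)
  ell_pos : 0 < ℓ
  tendsto_zero : Tendsto (fun x : ℝ => Ψ x / x ^ 2) (𝓝[>] 0) (𝓝 ℓ)
  tendsto_infty : Tendsto (fun x : ℝ => Ψ x / Real.log (|x| + 1)) atTop atTop
  integrable : Integrable (fun x : ℝ => 1 / (1 + Ψ x)) volume

/-- The Fourier transform `f̂(ξ) = ∫ exp (-i ξ x) f(x) dx`. -/
noncomputable def fourierHat (f : ℝ → ℝ) (ξ : ℝ) : ℂ :=
  ∫ x : ℝ, Complex.exp (-Complex.I * (ξ : ℂ) * (x : ℂ)) * (f x : ℂ)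

/-- The class of admissible functions: `f ∈ L¹ ∩ L^∞`, `f̂ ∈ L¹`, and
`|f̂(x) - f̂(0)| / x²` is integrable over the line. -/
structure IsAdmissibleFunction (f : ℝ → ℝ) : Prop where
  integrable : Integrable f volume
  essBounded : MemLp f ∞ volume
  fourier_integrable : Integrable (fourierHat f) volume
  fourier_diff_integrable :
    Integrable (fun x : ℝ => ‖fourierHat f x - fourierHat f 0‖ / x ^ 2) volume

/-- The normalized additive functional `c⁻¹ ∫₀^{t² c²} f(X_s) ds`, as a random variable. -/
noncomputable def additiveFunctional {Ω : Type*} (X : ℝ≥0 → Ω → ℝ) (f : ℝ → ℝ) (c t : ℝ)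
    (ω : Ω) : ℝ :=
  c⁻¹ * ∫ s in (0 : ℝ)..(t ^ 2 * c ^ 2), f (X s.toNNReal ω)

end LevyFunctional

/-! Fourier inversion gives `X_s`, `s > 0`, a bounded continuous density `p_s`. After the rescaling
`x = z / √s`, the behaviour `Ψ x ~ ℓ x²` at zero and the domination of the logarithm at infinity
allow dominated convergence in the inversion integral, so `√s p_s(y) → (2 √(πℓ))⁻¹`, with a bound
uniform in `y` and in large `s`. Hence `√s E f(X_s)` and, by the Markov property,
`√r √u E[f(X_r) f(X_{r+u})]` converge to `κ` and `κ²`, where `κ = (2 √(πℓ))⁻¹ ∫ f`, and they are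
bounded by constants. Averaging over `0 < s < S` produces the factor `∫₀¹ ρ^{-1/2} dρ = 2` in the
mean, and averaging over the triangle `0 < r < s < S` the Beta integral
`∫₀¹ (ρ (1 - ρ))^{-1/2} dρ = π` in the second moment. -/

namespace LevyFunctional

/-! ### Fourier inversion for finite measures -/

section FourierInversion

open scoped FourierTransform ContDiff SchwartzMap

variable {V : Type*} [NormedAddCommGroup V] [MeasurableSpace V] [BorelSpace V]

theorem tendsto_integral_of_contDiff_approx (μ : Measure V) [IsFiniteMeasureOnCompacts μ]
    {f : V → ℝ} (hf : HasCompactSupport f) {g : ℕ → V → ℝ}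
    (hg : ∀ n, Continuous (g n)) (hfc : Continuous f)
    (hgf : ∀ n x, dist (g n x) (f x) < 1 / ((n : ℝ) + 1))
    (hsupp : ∀ n, Function.support (g n) ⊆ Function.support f) :
    Tendsto (fun n => ∫ x, g n x ∂μ) atTop (𝓝 (∫ x, f x ∂μ)) := by
  refine tendsto_integral_of_dominated_convergence ((tsupport f).indicator fun x => ‖f x‖ + 1)
    (fun n => (hg n).aestronglyMeasurable) ?_ (fun n => .of_forall fun x => ?_)
    (.of_forall fun x => ?_)
  · exact ((hfc.norm.add continuous_const).continuousOn.integrableOn_compact hf)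
      |>.integrable_indicator (isClosed_tsupport f).measurableSet
  · by_cases hx : x ∈ tsupport f
    · have hle_one : 1 / ((n : ℝ) + 1) ≤ 1 := by
        rw [div_le_one (by positivity)]; linarith [(n.cast_nonneg : (0 : ℝ) ≤ n)]
      rw [Set.indicator_of_mem hx]
      linarith [hgf n x, norm_le_norm_add_norm_sub' (g n x) (f x), dist_eq_norm (g n x) (f x)]
    · have : g n x = 0 := by
        by_contra h
        exact hx (subset_tsupport f (hsupp n h))
      rw [this, norm_zero, Set.indicator_of_notMem hx]
  · exact tendsto_iff_dist_tendsto_zero.2 (squeeze_zero (fun _ => dist_nonneg)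
      (fun n => (hgf n x).le) tendsto_one_div_add_atTop_nhds_zero_nat)

variable [InnerProductSpace ℝ V] [FiniteDimensional ℝ V]

theorem ext_of_forall_integral_contDiff {μ ν : Measure V} [IsFiniteMeasureOnCompacts μ]
    [IsFiniteMeasureOnCompacts ν]
    (h : ∀ g : V → ℝ, ContDiff ℝ ∞ g → HasCompactSupport g → ∫ x, g x ∂μ = ∫ x, g x ∂ν) :
    μ = ν := by
  refine Measure.ext_of_integral_eq_on_compactlySupported fun f => ?_
  choose g hg hgf hsupp using fun n : ℕ => f.continuous.exists_contDiff_approx ⊤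
    (continuous_const (y := 1 / ((n : ℝ) + 1))) fun _ => by positivity
  have hlim := fun (ρ : Measure V) [IsFiniteMeasureOnCompacts ρ] =>
    tendsto_integral_of_contDiff_approx ρ f.hasCompactSupport (fun n => (hg n).continuous)
      f.continuous hgf hsupp
  refine tendsto_nhds_unique (hlim μ) ((hlim ν).congr fun n => (h _ (hg n) ?_).symm)
  exact f.hasCompactSupport.mono (hsupp n)

/-- The candidate density of `μ`, by Fourier inversion of its characteristic function. The kernel
of `𝓕` is `exp (-2πi⟪ξ, y⟫)`, hence the dilation of `charFun μ` by `2π`. -/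
noncomputable def fourierDensity (μ : Measure V) (y : V) : ℝ :=
  (𝓕 (fun ξ => charFun μ ((2 * Real.pi) • ξ)) y).re

variable {μ : Measure V}

theorem continuous_fourierDensity
    (hμ : Integrable fun ξ => charFun μ ((2 * Real.pi) • ξ)) :
    Continuous (fourierDensity μ) :=
  Complex.continuous_re.comp (VectorFourier.fourierIntegral_continuous Real.continuous_fourierChar
    (L := innerₗ V) continuous_inner hμ)

variable [IsFiniteMeasure μ]

theorem integral_charFun_mul_fourier (g : 𝓢(V, ℂ)) :
    ∫ ξ, (𝓕 g : 𝓢(V, ℂ)) ξ * charFun μ ((2 * Real.pi) • ξ) = ∫ x, g x ∂μ := by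
  have hcharFun (ξ : V) :
      VectorFourier.fourierIntegral Real.fourierChar μ (-innerₗ V) 1 ξ
        = charFun μ ((2 * Real.pi) • ξ) := by
    rw [charFun_eq_fourierIntegral', smul_smul, neg_mul, inv_mul_cancel₀ Real.two_pi_pos.ne']
    simp [VectorFourier.fourierIntegral]
  have hinv (x : V) :
      VectorFourier.fourierIntegral Real.fourierChar volume (-innerₗ V).flip (𝓕 g : 𝓢(V, ℂ)) x
        = g x := by
    conv_rhs => rw [← FourierTransform.fourierInv_fourier_eq g (E := 𝓢(V, ℂ)) (F := 𝓢(V, ℂ))]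
    rw [SchwartzMap.fourierInv_coe, Real.fourierInv_eq]
    simp [VectorFourier.fourierIntegral, real_inner_comm]
  have h := VectorFourier.integral_fourierIntegral_smul_eq_flip (L := -innerₗ V) (μ := μ)
    (ν := volume) (f := 1) (g := (𝓕 g : 𝓢(V, ℂ))) Real.continuous_fourierChar
    continuous_inner.neg (integrable_const 1) (𝓕 g : 𝓢(V, ℂ)).integrable
  simpa only [hcharFun, hinv, Pi.one_apply, smul_eq_mul, one_mul, mul_comm] using h

theorem integral_eq_integral_mul_fourierDensity
    (hμ : Integrable fun ξ => charFun μ ((2 * Real.pi) • ξ)) {g : V → ℝ} (hg : ContDiff ℝ ∞ g)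
    (hgc : HasCompactSupport g) :
    ∫ x, g x ∂μ = ∫ y, g y * fourierDensity μ y := by
  let G : 𝓢(V, ℂ) := (hgc.comp_left Complex.ofReal_zero).toSchwartzMap
    (Complex.ofRealCLM.contDiff.comp hg)
  set φ : V → ℂ := fun ξ => charFun μ ((2 * Real.pi) • ξ) with hφ
  have hφc : Continuous (𝓕 φ) := VectorFourier.fourierIntegral_continuous
    Real.continuous_fourierChar (L := innerₗ V) continuous_inner hμ
  have hG : ∫ x, (g x : ℂ) ∂μ = ∫ y, (g y : ℂ) * 𝓕 φ y := by
    refine (integral_charFun_mul_fourier G).symm.trans ?_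
    simpa using! VectorFourier.integral_fourierIntegral_smul_eq_flip (L := innerₗ V) (μ := volume)
      (ν := volume) Real.continuous_fourierChar continuous_inner G.integrable hμ
  have hint : Integrable fun y => (g y : ℂ) * 𝓕 φ y :=
    ((Complex.continuous_ofReal.comp hg.continuous).mul hφc).integrable_of_hasCompactSupport
      (hgc.comp_left Complex.ofReal_zero).mul_right
  rw [integral_complex_ofReal] at hG
  rw [← Complex.ofReal_re (∫ x, g x ∂μ), hG, ← RCLike.re_eq_complex_re, ← integral_re hint]
  simp [fourierDensity, hφ]

theorem fourierDensity_nonneg (hμ : Integrable fun ξ => charFun μ ((2 * Real.pi) • ξ)) (y : V) :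
    0 ≤ fourierDensity μ y := by
  by_contra! hy
  obtain ⟨r, hr, hball⟩ := Metric.isOpen_iff.1
    (isOpen_lt (continuous_fourierDensity hμ) (continuous_const (y := (0 : ℝ)))) y hy
  let b : ContDiffBump y := ⟨r / 2, r, half_pos hr, half_lt_self hr⟩
  have hpos : 0 < ∫ x, b x * -fourierDensity μ x := by
    refine (b.continuous.mul (continuous_fourierDensity hμ).neg)
      |>.integral_pos_of_hasCompactSupport_nonneg_nonzero b.hasCompactSupport.mul_right
      (fun x => ?_) (x := y) ?_
    · rcases lt_or_ge (dist x y) r with hx | hx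
      · exact mul_nonneg b.nonneg (neg_nonneg.2 (hball hx).le)
      · simp [b.zero_of_le_dist hx]
    · simp [b.one_of_mem_closedBall (Metric.mem_closedBall_self (half_pos hr).le), hy.ne]
  have := integral_eq_integral_mul_fourierDensity hμ b.contDiff b.hasCompactSupport
  have hnonneg : 0 ≤ ∫ x, b x ∂μ := integral_nonneg fun x => b.nonneg
  simp only [mul_neg, integral_neg] at hpos
  linarith

theorem eq_withDensity_fourierDensity
    (hμ : Integrable fun ξ => charFun μ ((2 * Real.pi) • ξ)) :
    μ = volume.withDensity fun y => ENNReal.ofReal (fourierDensity μ y) := by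
  have hp := continuous_fourierDensity hμ
  have : IsLocallyFiniteMeasure (volume.withDensity fun y => ENNReal.ofReal (fourierDensity μ y)) :=
    IsLocallyFiniteMeasure.withDensity_ofReal hp
  refine ext_of_forall_integral_contDiff fun g hg hgc => ?_
  rw [integral_withDensity_eq_integral_toReal_smul (by fun_prop) (by simp),
    integral_eq_integral_mul_fourierDensity hμ hg hgc]
  simp only [ENNReal.toReal_ofReal (fourierDensity_nonneg hμ _), smul_eq_mul, mul_comm]

end FourierInversion

/-! ### Characteristic exponents and the local limit theorem -/

/-- The exponents to which the local limit argument applies: `exp (-s Ψ)` is the characteristic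
function of a law on `ℝ` for every `s > 0` (a symmetric law, `Ψ` being real),
`Ψ x ~ ℓ x²` at zero, and `Ψ` dominates the logarithm at infinity. -/
structure IsRegularExponent (Ψ : ℝ → ℝ) (ℓ : ℝ) : Prop where
  exists_law : ∀ s > 0, ∃ μ : Measure ℝ, IsProbabilityMeasure μ ∧
    ∀ x, charFun μ x = (Real.exp (-s * Ψ x) : ℝ)
  ell_pos : 0 < ℓ
  tendsto_zero : Tendsto (fun x => Ψ x / x ^ 2) (𝓝[>] 0) (𝓝 ℓ)
  tendsto_infty : Tendsto (fun x => Ψ x / Real.log (|x| + 1)) atTop atTop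

theorem one_sub_re_charFun (μ : Measure ℝ) [IsProbabilityMeasure μ] (x : ℝ) :
    1 - (charFun μ x).re = ∫ y, (1 - Real.cos (x * y)) ∂μ := by
  have hcos : Integrable (fun y => Real.cos (x * y)) μ :=
    Integrable.of_bound (by fun_prop) 1 (.of_forall fun y => Real.abs_cos_le_one _)
  have hexp : Integrable (fun y : ℝ => Complex.exp (x * y * Complex.I)) μ :=
    Integrable.of_bound (by fun_prop) 1 (.of_forall fun y => by
      rw [← Complex.ofReal_mul, Complex.norm_exp_ofReal_mul_I])
  rw [charFun_apply_real, ← RCLike.re_eq_complex_re, ← integral_re hexp,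
    integral_sub (integrable_const 1) hcos]
  simp [← Complex.ofReal_mul, Complex.exp_ofReal_mul_I_re]

theorem one_sub_re_charFun_two_mul_le (μ : Measure ℝ) [IsProbabilityMeasure μ] (x : ℝ) :
    1 - (charFun μ (2 * x)).re ≤ 4 * (1 - (charFun μ x).re) := by
  have hint (c : ℝ) : Integrable (fun y => 1 - Real.cos (c * y)) μ :=
    (integrable_const 1).sub <|
      Integrable.of_bound (by fun_prop) 1 (.of_forall fun y => Real.abs_cos_le_one _)
  rw [one_sub_re_charFun, one_sub_re_charFun, ← integral_const_mul]
  refine integral_mono (hint _) ((hint x).const_mul 4) fun y => ?_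
  simp only [mul_assoc, Real.cos_two_mul]
  nlinarith [sq_nonneg (1 - Real.cos (x * y))]

theorem exp_neg_mul_le_rpow {s K x a : ℝ} (hs : 0 ≤ s) (h : K * Real.log (|x| + 1) ≤ a) :
    Real.exp (-s * a) ≤ (1 + ‖x‖) ^ (-(s * K)) := by
  rw [Real.rpow_def_of_pos (by positivity), Real.exp_le_exp, Real.norm_eq_abs, add_comm 1]
  linarith [mul_le_mul_of_nonneg_left h hs]

namespace IsRegularExponent

variable {Ψ : ℝ → ℝ} {ℓ : ℝ}

theorem apply_neg (h : IsRegularExponent Ψ ℓ) (x : ℝ) : Ψ (-x) = Ψ x := by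
  obtain ⟨μ, _, hμ⟩ := h.exists_law 1 one_pos
  have := charFun_neg (μ := μ) x
  rw [hμ, hμ, Complex.conj_ofReal, Complex.ofReal_inj, Real.exp_eq_exp] at this
  linarith

theorem apply_abs (h : IsRegularExponent Ψ ℓ) (x : ℝ) : Ψ |x| = Ψ x := by
  rcases abs_choice x with hx | hx <;> simp only [hx, h.apply_neg]

theorem nonneg (h : IsRegularExponent Ψ ℓ) (x : ℝ) : 0 ≤ Ψ x := by
  obtain ⟨μ, _, hμ⟩ := h.exists_law 1 one_pos
  have := norm_charFun_le_one (μ := μ) x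
  rw [hμ, Complex.norm_real, Real.norm_eq_abs, Real.abs_exp, Real.exp_le_one_iff] at this
  linarith

theorem continuous (h : IsRegularExponent Ψ ℓ) : Continuous Ψ := by
  obtain ⟨μ, _, hμ⟩ := h.exists_law 1 one_pos
  have hre (x : ℝ) : (charFun μ x).re = Real.exp (-1 * Ψ x) := by rw [hμ, Complex.ofReal_re]
  have hΨ : Ψ = fun x => -Real.log (charFun μ x).re := by
    ext x
    rw [hre, Real.log_exp]
    ring
  rw [hΨ]
  exact ((Complex.continuous_re.comp continuous_charFun).log
    fun x => (hre x).trans_ne (Real.exp_pos _).ne').neg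

theorem apply_two_mul_eq_zero (h : IsRegularExponent Ψ ℓ) {x : ℝ} (hx : Ψ x = 0) :
    Ψ (2 * x) = 0 := by
  obtain ⟨μ, _, hμ⟩ := h.exists_law 1 one_pos
  have := one_sub_re_charFun_two_mul_le μ x
  simp only [hμ, Complex.ofReal_re, hx, mul_zero, Real.exp_zero, sub_self, sub_nonpos,
    Real.one_le_exp_iff] at this
  linarith [h.nonneg (2 * x)]

theorem eventually_mul_log_le (h : IsRegularExponent Ψ ℓ) (K : ℝ) :
    ∀ᶠ x in atTop, K * Real.log (|x| + 1) ≤ Ψ x := by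
  filter_upwards [h.tendsto_infty.eventually_ge_atTop K, eventually_gt_atTop 0] with x hK hx
  exact (le_div_iff₀ (Real.log_pos (by rw [abs_of_pos hx]; linarith))).1 hK

theorem pos (h : IsRegularExponent Ψ ℓ) {x : ℝ} (hx : x ≠ 0) : 0 < Ψ x := by
  wlog hpos : 0 < x generalizing x
  · rw [← h.apply_neg]
    exact this (neg_ne_zero.2 hx) (neg_pos.2 (lt_of_le_of_ne (not_lt.1 hpos) hx))
  refine (h.nonneg x).lt_of_ne' fun h0 => ?_
  have hzero (n : ℕ) : Ψ (2 ^ n * x) = 0 := by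
    induction n with
    | zero => simpa using h0
    | succ n ih => rw [pow_succ', mul_assoc, h.apply_two_mul_eq_zero ih]
  have hlim : Tendsto (fun n : ℕ => (2 : ℝ) ^ n * x) atTop atTop :=
    (tendsto_pow_atTop_atTop_of_one_lt one_lt_two).atTop_mul_const hpos
  obtain ⟨n, hn⟩ := (hlim.eventually (h.eventually_mul_log_le 1)).exists
  have hlog : 0 < Real.log (|2 ^ n * x| + 1) := Real.log_pos (by
    have : 0 < |2 ^ n * x| := by positivity
    linarith)
  rw [hzero] at hn
  linarith

theorem exists_mul_log_le (h : IsRegularExponent Ψ ℓ) {δ : ℝ} (hδ : 0 < δ) :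
    ∃ κ > 0, ∀ x, δ ≤ |x| → κ * Real.log (|x| + 1) ≤ Ψ x := by
  obtain ⟨R, hR⟩ := eventually_atTop.1 (h.eventually_mul_log_le 1)
  have hlog {x : ℝ} (hx : δ ≤ x) : 0 < Real.log (|x| + 1) :=
    Real.log_pos (by linarith [le_abs_self x])
  obtain ⟨x₀, hx₀, hmin⟩ := isCompact_Icc.exists_isMinOn
    (Set.nonempty_Icc.2 (le_max_left δ R)) (f := fun x => Ψ x / Real.log (|x| + 1))
    (h.continuous.continuousOn.div ((by fun_prop : Continuous fun x : ℝ => |x| + 1).continuousOn.log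
      fun x _ => by positivity) fun x hx => (hlog hx.1).ne')
  have hκ : 0 < Ψ x₀ / Real.log (|x₀| + 1) :=
    div_pos (h.pos (hδ.trans_le hx₀.1).ne') (hlog hx₀.1)
  refine ⟨min 1 (Ψ x₀ / Real.log (|x₀| + 1)), lt_min one_pos hκ, ?_⟩
  suffices hpos : ∀ x ≥ δ, min 1 (Ψ x₀ / Real.log (|x₀| + 1)) * Real.log (|x| + 1) ≤ Ψ x from
    fun x hx => by simpa only [abs_abs, h.apply_abs] using hpos |x| hx
  intro x hx
  rcases le_total x (max δ R) with hxR | hxR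
  · exact (mul_le_mul_of_nonneg_right (min_le_right _ _) (hlog hx).le).trans
      ((le_div_iff₀ (hlog hx)).1 (hmin ⟨hx, hxR⟩))
  · exact (mul_le_mul_of_nonneg_right (min_le_left _ _) (hlog hx).le).trans
      (hR _ ((le_max_right δ R).trans hxR))

theorem tendsto_div_sq (h : IsRegularExponent Ψ ℓ) :
    Tendsto (fun x => Ψ x / x ^ 2) (𝓝[≠] 0) (𝓝 ℓ) := by
  rw [← Set.Iio_union_Ioi, nhdsWithin_union, tendsto_sup]
  refine ⟨?_, h.tendsto_zero⟩
  have hneg : Tendsto (Neg.neg : ℝ → ℝ) (𝓝[<] 0) (𝓝[>] 0) := by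
    simpa using tendsto_neg_nhdsLT (a := (0 : ℝ))
  simpa only [Function.comp_def, h.apply_neg, neg_sq] using h.tendsto_zero.comp hneg

theorem exists_mul_sq_le (h : IsRegularExponent Ψ ℓ) :
    ∃ δ > 0, ∀ x, |x| < δ → ℓ / 2 * x ^ 2 ≤ Ψ x := by
  obtain ⟨δ, hδ, hball⟩ := Metric.eventually_nhds_iff.1 <| eventually_nhdsWithin_iff.1 <|
    h.tendsto_div_sq.eventually_const_le (half_lt_self h.ell_pos)
  refine ⟨δ, hδ, fun x hx => ?_⟩
  rcases eq_or_ne x 0 with rfl | hx0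
  · simpa using h.nonneg 0
  · exact (le_div_iff₀ (by positivity)).1 (hball (by simpa using hx) hx0)

theorem tendsto_mul_apply_div_sqrt (h : IsRegularExponent Ψ ℓ) {z : ℝ} (hz : z ≠ 0) :
    Tendsto (fun s => s * Ψ (z / √s)) atTop (𝓝 (ℓ * z ^ 2)) := by
  have hlim : Tendsto (fun s => z / √s) atTop (𝓝[≠] 0) := by
    refine tendsto_nhdsWithin_iff.2 ⟨Real.tendsto_sqrt_atTop.const_div_atTop _, ?_⟩
    filter_upwards [eventually_gt_atTop 0] with s hs
    exact div_ne_zero hz (Real.sqrt_pos.2 hs).ne'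
  refine ((h.tendsto_div_sq.comp hlim).mul_const (z ^ 2)).congr' ?_
  filter_upwards [eventually_gt_atTop 0] with s hs
  simp only [Function.comp_apply, div_pow, Real.sq_sqrt hs.le]
  field_simp

theorem integrable_exp (h : IsRegularExponent Ψ ℓ) {s : ℝ} (hs : 0 < s) :
    Integrable fun x => Real.exp (-s * Ψ x) := by
  have hcont : Continuous fun x => Real.exp (-s * Ψ x) := (h.continuous.const_mul _).rexp
  refine hcont.locallyIntegrable.integrable_of_isBigO_cocompact
    (g := fun x => (1 + ‖x‖) ^ (-2 : ℝ)) (.of_bound 1 ?_)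
    ((integrable_one_add_norm (μ := volume) (by norm_num)).integrableAtFilter _)
  have htail : ∀ᶠ x in cocompact ℝ, 2 / s * Real.log (|x| + 1) ≤ Ψ x := by
    simpa only [Real.norm_eq_abs, abs_abs, h.apply_abs] using
      (tendsto_norm_cocompact_atTop (E := ℝ)).eventually (h.eventually_mul_log_le (2 / s))
  filter_upwards [htail] with x hx
  rw [one_mul, Real.norm_of_nonneg (Real.exp_nonneg _), Real.norm_of_nonneg (by positivity)]
  simpa only [mul_div_cancel₀ (2 : ℝ) hs.ne'] using exp_neg_mul_le_rpow hs.le hx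

theorem exists_exp_rescaled_le (h : IsRegularExponent Ψ ℓ) :
    ∃ s₀ > 0, ∀ s ≥ s₀, ∀ z,
      Real.exp (-s * Ψ (z / √s)) ≤ Real.exp (-(ℓ / 2) * z ^ 2) + (1 + ‖z‖) ^ (-2 : ℝ) := by
  obtain ⟨δ, hδ, hquad⟩ := h.exists_mul_sq_le
  obtain ⟨κ, hκ, hlog⟩ := h.exists_mul_log_le hδ
  refine ⟨max 1 (2 / κ) ^ 2, by positivity, fun s hs z => ?_⟩
  have hs0 : 0 < s := lt_of_lt_of_le (by positivity) hs
  have hsqrt : max 1 (2 / κ) ≤ √s := Real.le_sqrt_of_sq_le hs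
  rcases lt_or_ge |z / √s| δ with hz | hz
  · refine le_add_of_le_of_nonneg (Real.exp_le_exp.2 ?_) (by positivity)
    have := mul_le_mul_of_nonneg_left (hquad _ hz) hs0.le
    rw [div_pow, Real.sq_sqrt hs0.le] at this
    field_simp at this ⊢
    linarith
  · refine le_add_of_nonneg_of_le (Real.exp_nonneg _) ?_
    have hone : 1 ≤ √s := (le_max_left _ _).trans hsqrt
    have htwo : 2 ≤ √s * κ := (div_le_iff₀ hκ).1 ((le_max_right _ _).trans hsqrt)
    -- Bernoulli trades the growing exponent `√s` for the polynomial tail in `z`.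
    have hbern : 1 + ‖z‖ ≤ (1 + ‖z / √s‖) ^ √s := by
      refine le_trans (le_of_eq ?_)
        (one_add_mul_self_le_rpow_one_add (by linarith [norm_nonneg (z / √s)]) hone)
      rw [norm_div, Real.norm_of_nonneg (Real.sqrt_nonneg s)]
      field_simp
    calc Real.exp (-s * Ψ (z / √s))
        ≤ (1 + ‖z / √s‖) ^ (-(s * κ)) := exp_neg_mul_le_rpow hs0.le (hlog _ hz)
      _ = ((1 + ‖z / √s‖) ^ √s) ^ (-(√s * κ)) := by
          rw [← Real.rpow_mul (by positivity), mul_neg, ← mul_assoc, Real.mul_self_sqrt hs0.le]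
      _ ≤ (1 + ‖z‖) ^ (-(√s * κ)) :=
          Real.rpow_le_rpow_of_nonpos (by positivity) hbern (by linarith)
      _ ≤ (1 + ‖z‖) ^ (-2 : ℝ) :=
          Real.rpow_le_rpow_of_exponent_le (by linarith [norm_nonneg z]) (by linarith)

end IsRegularExponent

/-- The transition density at `y` of the law with characteristic function `exp (-s Ψ)`, for an even
exponent `Ψ`, given by Fourier inversion; meaningful only for `s > 0`. -/
noncomputable def density (Ψ : ℝ → ℝ) (s y : ℝ) : ℝ :=
  (2 * Real.pi)⁻¹ * ∫ x, Real.cos (x * y) * Real.exp (-s * Ψ x)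

/-- The constant of the local limit theorem, i.e. the value at `0` of the density of the centred
Gaussian law with variance `2ℓ`: the limit of `√s * density Ψ s y` when `Ψ x ~ ℓ x²`. -/
noncomputable def heatConst (ℓ : ℝ) : ℝ := (2 * √(Real.pi * ℓ))⁻¹

theorem sqrt_mul_density (Ψ : ℝ → ℝ) {s : ℝ} (hs : 0 < s) (y : ℝ) :
    √s * density Ψ s y = (2 * Real.pi)⁻¹ *
      ∫ z, Real.cos (z / √s * y) * Real.exp (-s * Ψ (z / √s)) := by
  rw [Measure.integral_comp_div (fun x => Real.cos (x * y) * Real.exp (-s * Ψ x)),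
    abs_of_pos (Real.sqrt_pos.2 hs), smul_eq_mul, density]
  ring

theorem integrable_gaussian_add_rpow {b : ℝ} (hb : 0 < b) :
    Integrable fun z : ℝ => Real.exp (-b * z ^ 2) + (1 + ‖z‖) ^ (-2 : ℝ) :=
  (integrable_exp_neg_mul_sq hb).add (integrable_one_add_norm (by norm_num))

theorem norm_cos_mul_exp_le (a b : ℝ) : ‖Real.cos a * Real.exp b‖ ≤ Real.exp b := by
  rw [norm_mul, Real.norm_of_nonneg (Real.exp_nonneg b)]
  exact mul_le_of_le_one_left (Real.exp_nonneg b) (Real.abs_cos_le_one a)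

namespace IsRegularExponent

variable {Ψ : ℝ → ℝ} {ℓ : ℝ}

section Law
variable {μ : Measure ℝ} {s : ℝ}

theorem integrable_charFun (h : IsRegularExponent Ψ ℓ) (hs : 0 < s)
    (hμ : ∀ x, charFun μ x = (Real.exp (-s * Ψ x) : ℝ)) :
    Integrable fun ξ : ℝ => charFun μ ((2 * Real.pi) • ξ) := by
  simp only [hμ, smul_eq_mul]
  exact ((h.integrable_exp hs).comp_mul_left' Real.two_pi_pos.ne').ofReal

theorem fourierDensity_eq_density (h : IsRegularExponent Ψ ℓ) (hs : 0 < s)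
    (hμ : ∀ x, charFun μ x = (Real.exp (-s * Ψ x) : ℝ)) (y : ℝ) :
    fourierDensity μ y = density Ψ s y := by
  have hre (ξ : ℝ) : (Real.fourierChar (-(ξ * y)) • charFun μ ((2 * Real.pi) • ξ)).re
      = Real.cos ((2 * Real.pi * ξ) * y) * Real.exp (-s * Ψ (2 * Real.pi * ξ)) := by
    rw [hμ, Circle.smul_def, smul_eq_mul, Complex.re_mul_ofReal, Real.fourierChar_apply,
      Complex.exp_ofReal_mul_I_re, smul_eq_mul, ← Real.cos_neg]
    ring_nf
  have hint : Integrable fun ξ : ℝ =>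
      Real.fourierChar (-(ξ * y)) • charFun μ ((2 * Real.pi) • ξ) := by
    simpa only [innerₗ_apply_apply, RCLike.inner_apply, conj_trivial, mul_comm y] using
      (VectorFourier.fourierIntegral_convergent_iff Real.continuous_fourierChar (L := innerₗ ℝ)
        continuous_inner y).2 (h.integrable_charFun hs hμ)
  have hsub := Measure.integral_comp_mul_left
    (fun x => Real.cos (x * y) * Real.exp (-s * Ψ x)) (2 * Real.pi)
  rw [abs_of_pos (by positivity), smul_eq_mul] at hsub
  rw [density, ← hsub, fourierDensity, Real.fourier_real_eq, ← RCLike.re_eq_complex_re,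
    ← integral_re hint]
  exact integral_congr_ae (.of_forall hre)

theorem density_nonneg (h : IsRegularExponent Ψ ℓ) (hs : 0 < s) (y : ℝ) : 0 ≤ density Ψ s y := by
  obtain ⟨μ, _, hμ⟩ := h.exists_law s hs
  rw [← h.fourierDensity_eq_density hs hμ]
  exact fourierDensity_nonneg (h.integrable_charFun hs hμ) y

theorem continuous_density (h : IsRegularExponent Ψ ℓ) (hs : 0 < s) :
    Continuous (density Ψ s) := by
  obtain ⟨μ, _, hμ⟩ := h.exists_law s hs
  rw [← funext (h.fourierDensity_eq_density hs hμ)]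
  exact continuous_fourierDensity (h.integrable_charFun hs hμ)

theorem eq_withDensity_density (h : IsRegularExponent Ψ ℓ) (hs : 0 < s) [IsFiniteMeasure μ]
    (hμ : ∀ x, charFun μ x = (Real.exp (-s * Ψ x) : ℝ)) :
    μ = volume.withDensity fun y => ENNReal.ofReal (density Ψ s y) := by
  simpa only [h.fourierDensity_eq_density hs hμ] using
    eq_withDensity_fourierDensity (h.integrable_charFun hs hμ)

theorem integral_eq_density_mul (h : IsRegularExponent Ψ ℓ) (hs : 0 < s) [IsFiniteMeasure μ]
    (hμ : ∀ x, charFun μ x = (Real.exp (-s * Ψ x) : ℝ)) (g : ℝ → ℝ) :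
    ∫ y, g y ∂μ = ∫ y, density Ψ s y * g y := by
  rw [h.eq_withDensity_density hs hμ, integral_withDensity_eq_integral_toReal_smul
    (h.continuous_density hs).measurable.ennreal_ofReal (.of_forall fun _ => by simp)]
  simp only [ENNReal.toReal_ofReal (h.density_nonneg hs _), smul_eq_mul]

theorem integrable_density (h : IsRegularExponent Ψ ℓ) (hs : 0 < s) :
    Integrable (density Ψ s) := by
  obtain ⟨μ, _, hμ⟩ := h.exists_law s hs
  refine ⟨(h.continuous_density hs).aestronglyMeasurable,
    (hasFiniteIntegral_iff_ofReal (.of_forall (h.density_nonneg hs))).2 ?_⟩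
  rw [← setLIntegral_univ, ← withDensity_apply _ .univ, ← h.eq_withDensity_density hs hμ]
  exact measure_lt_top _ _

theorem integral_density (h : IsRegularExponent Ψ ℓ) (hs : 0 < s) :
    ∫ y, density Ψ s y = 1 := by
  obtain ⟨μ, _, hμ⟩ := h.exists_law s hs
  simpa using (h.integral_eq_density_mul hs hμ fun _ => 1).symm

end Law

theorem tendsto_sqrt_mul_density (h : IsRegularExponent Ψ ℓ) (y : ℝ) :
    Tendsto (fun s => √s * density Ψ s y) atTop (𝓝 (heatConst ℓ)) := by
  have hconst : heatConst ℓ = (2 * Real.pi)⁻¹ * ∫ z : ℝ, Real.exp (-ℓ * z ^ 2) := by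
    rw [integral_gaussian, heatConst, Real.sqrt_div' _ h.ell_pos.le, Real.sqrt_mul Real.pi_pos.le]
    have := h.ell_pos
    field_simp
    rw [Real.sq_sqrt Real.pi_pos.le]
  obtain ⟨s₀, -, hle⟩ := h.exists_exp_rescaled_le
  have hrw : ∀ᶠ s in atTop, (2 * Real.pi)⁻¹ *
      ∫ z, Real.cos (z / √s * y) * Real.exp (-s * Ψ (z / √s)) = √s * density Ψ s y := by
    filter_upwards [eventually_gt_atTop 0] with s hs using (sqrt_mul_density Ψ hs y).symm
  rw [hconst]
  refine Tendsto.congr' hrw (Tendsto.const_mul _ ?_)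
  refine tendsto_integral_filter_of_dominated_convergence _ ?_ ?_
    (integrable_gaussian_add_rpow (half_pos h.ell_pos)) ?_
  · have := h.continuous
    exact .of_forall fun s => (by fun_prop : Continuous _).aestronglyMeasurable
  · filter_upwards [eventually_ge_atTop s₀] with s hs
    exact .of_forall fun z => (norm_cos_mul_exp_le _ _).trans (hle s hs z)
  · filter_upwards [Measure.ae_ne volume 0] with z hz
    have hcos : Tendsto (fun s => Real.cos (z / √s * y)) atTop (𝓝 1) := by
      have := (Real.tendsto_sqrt_atTop.const_div_atTop z).mul_const y
      rw [zero_mul] at this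
      simpa only [Function.comp_def, Real.cos_zero] using (Real.continuous_cos.tendsto 0).comp this
    simpa using! hcos.mul (Real.continuous_exp.continuousAt.tendsto.comp
      (h.tendsto_mul_apply_div_sqrt hz).neg)

theorem exists_sqrt_mul_density_le (h : IsRegularExponent Ψ ℓ) :
    ∃ s₀ > 0, ∃ C, ∀ s ≥ s₀, ∀ y, √s * density Ψ s y ≤ C := by
  obtain ⟨s₀, hs₀, hle⟩ := h.exists_exp_rescaled_le
  refine ⟨s₀, hs₀, (2 * Real.pi)⁻¹ *
    ∫ z : ℝ, (Real.exp (-(ℓ / 2) * z ^ 2) + (1 + ‖z‖) ^ (-2 : ℝ)), fun s hs y => ?_⟩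
  rw [sqrt_mul_density Ψ (hs₀.trans_le hs)]
  refine mul_le_mul_of_nonneg_left ?_ (by positivity)
  exact (le_abs_self _).trans (norm_integral_le_of_norm_le
    (integrable_gaussian_add_rpow (half_pos h.ell_pos))
    (.of_forall fun z => (norm_cos_mul_exp_le _ _).trans (hle s hs z)))

end IsRegularExponent

/-! ### One-time and two-time means -/

/-- The transition semigroup: `transition Ψ s f x` stands for `E f(x + X_s)`. -/
noncomputable def transition (Ψ : ℝ → ℝ) (s : ℝ) (f : ℝ → ℝ) (x : ℝ) : ℝ :=
  ∫ z, density Ψ s z * f (x + z)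

/-- The two-time mean `E[f(X_r) f(X_{r+u})]` of a process started at `0`. -/
noncomputable def twoTimeMean (Ψ : ℝ → ℝ) (f : ℝ → ℝ) (r u : ℝ) : ℝ :=
  ∫ x, density Ψ r x * (f x * transition Ψ u f x)

theorem ae_eq_comp_add_left {f g : ℝ → ℝ} (hfg : f =ᵐ[volume] g) (x : ℝ) :
    (fun z => f (x + z)) =ᵐ[volume] fun z => g (x + z) :=
  (measurePreserving_add_left volume x).quasiMeasurePreserving.ae_eq_comp hfg

theorem memLp_comp_add_left {f : ℝ → ℝ} {p : ℝ≥0∞} (hf : MemLp f p) (x : ℝ) :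
    MemLp (fun z => f (x + z)) p :=
  hf.comp_measurePreserving (measurePreserving_add_left volume x)

namespace IsRegularExponent

variable {Ψ : ℝ → ℝ} {ℓ : ℝ} {f : ℝ → ℝ}

theorem stronglyMeasurable_density (h : IsRegularExponent Ψ ℓ) :
    StronglyMeasurable (Function.uncurry (density Ψ)) := by
  have := h.continuous
  have hcont : Continuous fun q : (ℝ × ℝ) × ℝ =>
    Real.cos (q.2 * q.1.2) * Real.exp (-q.1.1 * Ψ q.2) := by fun_prop
  exact hcont.stronglyMeasurable.integral_prod_right'.const_mul _

theorem stronglyMeasurable_transition (h : IsRegularExponent Ψ ℓ)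
    (hf : AEStronglyMeasurable f) :
    StronglyMeasurable fun p : ℝ × ℝ => transition Ψ p.1 f p.2 := by
  have hmk : (fun p : ℝ × ℝ => transition Ψ p.1 f p.2)
      = fun p => ∫ z, density Ψ p.1 z * hf.mk f (p.2 + z) := by
    ext p
    refine integral_congr_ae ?_
    filter_upwards [ae_eq_comp_add_left hf.ae_eq_mk p.2] with z hz
    rw [hz]
  rw [hmk]
  have hmeas : StronglyMeasurable fun q : (ℝ × ℝ) × ℝ =>
      density Ψ q.1.1 q.2 * hf.mk f (q.1.2 + q.2) :=
    (h.stronglyMeasurable_density.comp_measurable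
      (by fun_prop : Measurable fun q : (ℝ × ℝ) × ℝ => (q.1.1, q.2))).mul
    (hf.stronglyMeasurable_mk.comp_measurable (by fun_prop))
  exact hmeas.integral_prod_right'

theorem stronglyMeasurable_twoTimeMean (h : IsRegularExponent Ψ ℓ)
    (hf : AEStronglyMeasurable f) :
    StronglyMeasurable (Function.uncurry (twoTimeMean Ψ f)) := by
  have hmk : Function.uncurry (twoTimeMean Ψ f)
      = fun p => ∫ x, density Ψ p.1 x * (hf.mk f x * transition Ψ p.2 f x) := by
    ext p
    refine integral_congr_ae ?_
    filter_upwards [hf.ae_eq_mk] with x hx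
    rw [hx]
  rw [hmk]
  have hmeas : StronglyMeasurable fun q : (ℝ × ℝ) × ℝ =>
      density Ψ q.1.1 q.2 * (hf.mk f q.2 * transition Ψ q.1.2 f q.2) :=
    (h.stronglyMeasurable_density.comp_measurable
      (by fun_prop : Measurable fun q : (ℝ × ℝ) × ℝ => (q.1.1, q.2))).mul
    ((hf.stronglyMeasurable_mk.comp_measurable (by fun_prop)).mul
      ((h.stronglyMeasurable_transition hf).comp_measurable
        (by fun_prop : Measurable fun q : (ℝ × ℝ) × ℝ => (q.1.2, q.2))))
  exact hmeas.integral_prod_right'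

theorem norm_transition_le (h : IsRegularExponent Ψ ℓ) {s : ℝ} (hs : 0 < s) (x : ℝ) :
    ‖transition Ψ s f x‖ ≤ transition Ψ s (fun y => ‖f y‖) x := by
  refine (norm_integral_le_integral_norm _).trans_eq ?_
  simp only [norm_mul, Real.norm_of_nonneg (h.density_nonneg hs _), transition]

theorem integrable_density_mul (h : IsRegularExponent Ψ ℓ) {s : ℝ} (hs : 0 < s)
    (hf : MemLp f ∞) : Integrable fun z => density Ψ s z * f z :=
  (h.integrable_density hs).mul_of_top_left hf

theorem exists_transition_norm_le (h : IsRegularExponent Ψ ℓ) (hf : Integrable f)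
    (hf' : MemLp f ∞) :
    ∃ C, 0 ≤ C ∧ ∀ s > 0, ∀ x, transition Ψ s (fun y => ‖f y‖) x ≤ C * (√s)⁻¹ := by
  obtain ⟨s₀, -, C, hC⟩ := h.exists_sqrt_mul_density_le
  have hnorm (x : ℝ) : MemLp (fun z => ‖f (x + z)‖) ∞ := (memLp_comp_add_left hf' x).norm
  refine ⟨max (√s₀ * lpNorm f ∞ volume) (C * ∫ z, ‖f z‖),
    le_max_of_le_left (mul_nonneg (Real.sqrt_nonneg _) lpNorm_nonneg), fun s hs x => ?_⟩
  rw [← div_eq_mul_inv, le_div_iff₀' (Real.sqrt_pos.2 hs)]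
  rcases le_total s s₀ with hss | hss
  · refine le_max_of_le_left (mul_le_mul (Real.sqrt_le_sqrt hss) ?_ ?_ (Real.sqrt_nonneg _))
    · calc transition Ψ s (fun y => ‖f y‖) x
          ≤ ∫ z, density Ψ s z * lpNorm f ∞ volume := by
            refine integral_mono_ae (h.integrable_density_mul hs (hnorm x))
              ((h.integrable_density hs).mul_const _) ?_
            filter_upwards [(measurePreserving_add_left volume x).quasiMeasurePreserving.ae
              (ae_le_lpNorm_exponent_top hf')] with z hz
            exact mul_le_mul_of_nonneg_left hz (h.density_nonneg hs z)
        _ = lpNorm f ∞ volume := by rw [integral_mul_const, h.integral_density hs, one_mul]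
    · exact integral_nonneg fun z => mul_nonneg (h.density_nonneg hs z) (norm_nonneg _)
  · refine le_max_of_le_right ?_
    rw [transition, ← integral_const_mul, ← integral_const_mul,
      ← integral_add_left_eq_self (fun z => C * ‖f z‖) x]
    refine integral_mono ((h.integrable_density_mul hs (hnorm x)).const_mul _)
      ((hf.norm.comp_add_left x).const_mul C) fun z => ?_
    rw [← mul_assoc]
    exact mul_le_mul_of_nonneg_right (hC s hss z) (norm_nonneg _)

theorem tendsto_sqrt_mul_integral_density (h : IsRegularExponent Ψ ℓ) {ι : Type*} {l : Filter ι}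
    [l.IsCountablyGenerated] {r : ι → ℝ} (hr : Tendsto r l atTop) {φ : ι → ℝ → ℝ}
    {φ₀ Φ : ℝ → ℝ} (hmeas : ∀ᶠ i in l, AEStronglyMeasurable (φ i)) (hΦ : Integrable Φ)
    (hle : ∀ᶠ i in l, ∀ᵐ z, ‖φ i z‖ ≤ Φ z)
    (hlim : ∀ᵐ z, Tendsto (fun i => φ i z) l (𝓝 (φ₀ z))) :
    Tendsto (fun i => √(r i) * ∫ z, density Ψ (r i) z * φ i z) l
      (𝓝 (heatConst ℓ * ∫ z, φ₀ z)) := by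
  obtain ⟨s₀, hs₀, C, hC⟩ := h.exists_sqrt_mul_density_le
  simp only [← integral_const_mul, ← mul_assoc]
  refine tendsto_integral_filter_of_dominated_convergence (fun z => C * Φ z) ?_ ?_
    (hΦ.const_mul C) ?_
  · filter_upwards [hmeas, hr.eventually_gt_atTop 0] with i hi hri
    exact ((h.continuous_density hri).const_mul _).aestronglyMeasurable.mul hi
  · filter_upwards [hle, hr.eventually_ge_atTop s₀] with i hi hri
    filter_upwards [hi] with z hz
    have hnonneg : 0 ≤ √(r i) * density Ψ (r i) z :=
      mul_nonneg (Real.sqrt_nonneg _) (h.density_nonneg (hs₀.trans_le hri) z)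
    rw [norm_mul, Real.norm_of_nonneg hnonneg]
    exact mul_le_mul (hC _ hri z) hz (norm_nonneg _) (hnonneg.trans (hC _ hri z))
  · filter_upwards [hlim] with z hz using ((h.tendsto_sqrt_mul_density z).comp hr).mul hz

theorem tendsto_sqrt_mul_transition (h : IsRegularExponent Ψ ℓ) (hf : Integrable f) (x : ℝ) :
    Tendsto (fun s => √s * transition Ψ s f x) atTop (𝓝 (heatConst ℓ * ∫ z, f z)) := by
  rw [← integral_add_left_eq_self f x]
  exact h.tendsto_sqrt_mul_integral_density tendsto_id
    (.of_forall fun _ => (hf.comp_add_left x).1) (hf.comp_add_left x).norm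
    (.of_forall fun _ => .of_forall fun _ => le_rfl) (.of_forall fun _ => tendsto_const_nhds)

theorem tendsto_sqrt_mul_twoTimeMean (h : IsRegularExponent Ψ ℓ) (hf : Integrable f)
    (hf' : MemLp f ∞) :
    Tendsto (fun p : ℝ × ℝ => √p.1 * √p.2 * twoTimeMean Ψ f p.1 p.2) (atTop ×ˢ atTop)
      (𝓝 ((heatConst ℓ * ∫ z, f z) ^ 2)) := by
  obtain ⟨C, -, hC⟩ := h.exists_transition_norm_le hf hf'
  have hlim := h.tendsto_sqrt_mul_integral_density (l := atTop ×ˢ (atTop : Filter ℝ)) tendsto_fst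
    (φ := fun p z => f z * (√p.2 * transition Ψ p.2 f z))
    (φ₀ := fun z => f z * (heatConst ℓ * ∫ y, f y)) (Φ := fun z => ‖f z‖ * C)
    (.of_forall fun p => hf.1.mul (((h.stronglyMeasurable_transition hf.1).comp_measurable
      (by fun_prop : Measurable fun z : ℝ => (p.2, z))).const_mul _).aestronglyMeasurable)
    (hf.norm.mul_const C) ?_
    (.of_forall fun z => (((h.tendsto_sqrt_mul_transition hf z).comp tendsto_snd).const_mul _))
  · rw [integral_mul_const] at hlim
    convert hlim using 2 with p
    · rw [mul_assoc, twoTimeMean, ← integral_const_mul]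
      ring_nf
    · ring
  · filter_upwards [tendsto_snd.eventually_gt_atTop (0 : ℝ)] with p hp
    refine .of_forall fun z => ?_
    rw [norm_mul, norm_mul, Real.norm_of_nonneg (Real.sqrt_nonneg _)]
    gcongr
    rw [← le_div_iff₀' (Real.sqrt_pos.2 hp), div_eq_mul_inv]
    exact (h.norm_transition_le hp z).trans (hC _ hp z)

theorem exists_norm_twoTimeMean_le (h : IsRegularExponent Ψ ℓ) (hf : Integrable f)
    (hf' : MemLp f ∞) :
    ∃ C, ∀ r > 0, ∀ u > 0, ‖twoTimeMean Ψ f r u‖ ≤ C * (√r * √u)⁻¹ := by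
  obtain ⟨C, hC₀, hC⟩ := h.exists_transition_norm_le hf hf'
  refine ⟨C ^ 2, fun r hr u hu => ?_⟩
  calc ‖twoTimeMean Ψ f r u‖
      ≤ ∫ x, density Ψ r x * (‖f x‖ * (C * (√u)⁻¹)) := by
        refine norm_integral_le_of_norm_le (h.integrable_density_mul hr (hf'.norm.mul_const _)) ?_
        refine .of_forall fun x => ?_
        rw [norm_mul, norm_mul, Real.norm_of_nonneg (h.density_nonneg hr x)]
        gcongr
        · exact h.density_nonneg hr x
        · exact (h.norm_transition_le hu x).trans (hC u hu x)
    _ = transition Ψ r (fun y => ‖f y‖) 0 * (C * (√u)⁻¹) := by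
        simp only [transition, zero_add, ← integral_mul_const, mul_assoc]
    _ ≤ C * (√r)⁻¹ * (C * (√u)⁻¹) := by
        gcongr
        exact hC r hr 0
    _ = C ^ 2 * (√r * √u)⁻¹ := by
        rw [mul_inv]
        ring

end IsRegularExponent

/-! ### Averages in time -/

theorem tendsto_rpow_mul_integral {m : ℝ → ℝ} {α C L : ℝ} (hα : α < 1) (hm : StronglyMeasurable m)
    (hle : ∀ s > 0, ‖m s‖ ≤ C * s ^ (-α)) (hlim : Tendsto (fun s => s ^ α * m s) atTop (𝓝 L)) :
    Tendsto (fun S => S ^ (α - 1) * ∫ s in (0 : ℝ)..S, m s) atTop (𝓝 ((1 - α)⁻¹ * L)) := by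
  have hval : (1 - α)⁻¹ * L = ∫ ρ in (0 : ℝ)..1, ρ ^ (-α) * L := by
    rw [intervalIntegral.integral_mul_const, integral_rpow (.inl (by linarith)), Real.one_rpow,
      Real.zero_rpow (by linarith)]
    ring
  have hscale : ∀ᶠ S in atTop,
      ∫ ρ in (0 : ℝ)..1, S ^ α * m (S * ρ) = S ^ (α - 1) * ∫ s in (0 : ℝ)..S, m s := by
    filter_upwards [eventually_gt_atTop 0] with S hS
    rw [intervalIntegral.integral_const_mul, intervalIntegral.integral_comp_mul_left _ hS.ne',
      mul_zero, mul_one, smul_eq_mul, Real.rpow_sub_one hS.ne', div_eq_mul_inv, mul_assoc]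
  rw [hval]
  refine Tendsto.congr' hscale (intervalIntegral.tendsto_integral_filter_of_dominated_convergence
    (fun ρ => C * ρ ^ (-α)) ?_ ?_
    ((intervalIntegral.intervalIntegrable_rpow' (by linarith)).const_mul C) ?_)
  · exact .of_forall fun S =>
      ((hm.comp_measurable (measurable_const_mul S)).const_mul _).aestronglyMeasurable
  · filter_upwards [eventually_gt_atTop 0] with S hS
    refine .of_forall fun ρ hρ => ?_
    rw [Set.uIoc_of_le zero_le_one] at hρ
    rw [norm_mul, Real.norm_of_nonneg (by positivity)]
    calc S ^ α * ‖m (S * ρ)‖ ≤ S ^ α * (C * (S * ρ) ^ (-α)) := by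
          gcongr
          exact hle _ (mul_pos hS hρ.1)
      _ = C * ρ ^ (-α) := by
          rw [Real.mul_rpow hS.le hρ.1.le, Real.rpow_neg hS.le]
          field_simp
  · refine .of_forall fun ρ hρ => ?_
    rw [Set.uIoc_of_le zero_le_one] at hρ
    refine ((hlim.comp (tendsto_id.atTop_mul_const hρ.1)).const_mul (ρ ^ (-α))).congr' ?_
    filter_upwards [eventually_gt_atTop 0] with S hS
    simp only [Function.comp_apply, id_eq]
    rw [Real.mul_rpow hS.le hρ.1.le, Real.rpow_neg hρ.1.le]
    have := Real.rpow_pos_of_pos hρ.1 α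
    field_simp

theorem integral_inv_sqrt_mul_sqrt :
    ∫ ρ in (0 : ℝ)..1, (√ρ * √(1 - ρ))⁻¹ = Real.pi := by
  have hbeta : Complex.betaIntegral (1 / 2) (1 / 2) = Real.pi := by
    have hGamma := Complex.Gamma_mul_Gamma_eq_betaIntegral (s := 1 / 2) (t := 1 / 2)
      (by norm_num) (by norm_num)
    rw [Complex.Gamma_one_half_eq, ← Complex.cpow_add _ _ (by simp [Real.pi_ne_zero]), add_halves,
      Complex.cpow_one, Complex.Gamma_one, one_mul] at hGamma
    exact hGamma.symm
  have hpow {y : ℝ} (hy : 0 ≤ y) : (y : ℂ) ^ ((1 / 2 : ℂ) - 1) = (((√y)⁻¹ : ℝ) : ℂ) := by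
    rw [Real.sqrt_eq_rpow, ← Real.rpow_neg hy, Complex.ofReal_cpow hy]
    norm_num
  rw [← Complex.ofReal_inj, ← hbeta, Complex.betaIntegral, ← intervalIntegral.integral_ofReal]
  refine intervalIntegral.integral_congr fun x hx => ?_
  rw [Set.uIcc_of_le zero_le_one] at hx
  have hsub := hpow (sub_nonneg.2 hx.2)
  push_cast at hsub
  simp only [hpow hx.1, hsub, mul_inv]
  push_cast
  rfl

theorem intervalIntegrable_inv_sqrt_mul_sqrt :
    IntervalIntegrable (fun ρ : ℝ => (√ρ * √(1 - ρ))⁻¹) volume 0 1 := by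
  by_contra h
  exact Real.pi_ne_zero
    (integral_inv_sqrt_mul_sqrt.symm.trans (intervalIntegral.integral_undef h))

section Triangle

variable {G : ℝ → ℝ → ℝ} {C L : ℝ}

theorem integral_triangle_slice_eq {s : ℝ} (hs : 0 < s) :
    ∫ r in (0 : ℝ)..s, G r (s - r) = ∫ ρ in (0 : ℝ)..1, s * G (s * ρ) (s * (1 - ρ)) := by
  have := intervalIntegral.integral_comp_mul_left (a := 0) (b := 1) (fun r => G r (s - r)) hs.ne'
  rw [mul_zero, mul_one, smul_eq_mul, eq_inv_mul_iff_mul_eq₀ hs.ne'] at this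
  rw [← this, intervalIntegral.integral_const_mul]
  simp only [mul_sub, mul_one]

theorem norm_mul_comp_scaling_le (hle : ∀ r > 0, ∀ u > 0, ‖G r u‖ ≤ C * (√r * √u)⁻¹)
    {s : ℝ} (hs : 0 < s) {ρ : ℝ} (hρ : ρ ∈ Set.Ioo 0 1) :
    ‖s * G (s * ρ) (s * (1 - ρ))‖ ≤ C * (√ρ * √(1 - ρ))⁻¹ := by
  have hρ' : 0 < 1 - ρ := sub_pos.2 hρ.2
  rw [norm_mul, Real.norm_of_nonneg hs.le]
  calc s * ‖G (s * ρ) (s * (1 - ρ))‖ ≤ s * (C * (√(s * ρ) * √(s * (1 - ρ)))⁻¹) := by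
        gcongr
        exact hle _ (mul_pos hs hρ.1) _ (mul_pos hs hρ')
    _ = C * (√ρ * √(1 - ρ))⁻¹ := by
        rw [Real.sqrt_mul hs.le, Real.sqrt_mul hs.le, mul_mul_mul_comm, Real.mul_self_sqrt hs.le]
        field_simp

theorem ae_uIoc_zero_one_of_forall_Ioo {p : ℝ → Prop} (hp : ∀ ρ ∈ Set.Ioo (0 : ℝ) 1, p ρ) :
    ∀ᵐ ρ, ρ ∈ Set.uIoc (0 : ℝ) 1 → p ρ := by
  filter_upwards [Measure.ae_ne volume (1 : ℝ)] with ρ hne hρ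
  rw [Set.uIoc_of_le zero_le_one] at hρ
  exact hp ρ ⟨hρ.1, hρ.2.lt_of_ne hne⟩

theorem tendsto_integral_comp_scaling (hG : StronglyMeasurable (Function.uncurry G))
    (hle : ∀ r > 0, ∀ u > 0, ‖G r u‖ ≤ C * (√r * √u)⁻¹)
    (hlim : Tendsto (fun p : ℝ × ℝ => √p.1 * √p.2 * G p.1 p.2) (atTop ×ˢ atTop) (𝓝 L)) :
    Tendsto (fun s => ∫ ρ in (0 : ℝ)..1, s * G (s * ρ) (s * (1 - ρ))) atTop
      (𝓝 (Real.pi * L)) := by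
  rw [← integral_inv_sqrt_mul_sqrt, ← intervalIntegral.integral_mul_const]
  refine intervalIntegral.tendsto_integral_filter_of_dominated_convergence
    (fun ρ => C * (√ρ * √(1 - ρ))⁻¹) ?_ ?_
    (intervalIntegrable_inv_sqrt_mul_sqrt.const_mul C) ?_
  · exact .of_forall fun s => ((hG.comp_measurable (by fun_prop :
      Measurable fun ρ : ℝ => (s * ρ, s * (1 - ρ)))).const_mul s).aestronglyMeasurable
  · filter_upwards [eventually_gt_atTop 0] with s hs using
      ae_uIoc_zero_one_of_forall_Ioo fun ρ hρ => norm_mul_comp_scaling_le hle hs hρ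
  · refine ae_uIoc_zero_one_of_forall_Ioo fun ρ hρ => ?_
    have hρ' : 0 < 1 - ρ := sub_pos.2 hρ.2
    refine ((hlim.comp ((tendsto_id.atTop_mul_const hρ.1).prodMk
      (tendsto_id.atTop_mul_const hρ'))).const_mul (√ρ * √(1 - ρ))⁻¹).congr' ?_
    filter_upwards [eventually_gt_atTop 0] with s hs
    simp only [Function.comp_apply, id_eq]
    rw [Real.sqrt_mul hs.le, Real.sqrt_mul hs.le, mul_mul_mul_comm, Real.mul_self_sqrt hs.le]
    have hsqrt : 0 < √ρ := Real.sqrt_pos.2 hρ.1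
    field_simp

theorem tendsto_inv_mul_integral_triangle (hG : StronglyMeasurable (Function.uncurry G))
    (hle : ∀ r > 0, ∀ u > 0, ‖G r u‖ ≤ C * (√r * √u)⁻¹)
    (hlim : Tendsto (fun p : ℝ × ℝ => √p.1 * √p.2 * G p.1 p.2) (atTop ×ˢ atTop) (𝓝 L)) :
    Tendsto (fun S => S⁻¹ * ∫ s in (0 : ℝ)..S, ∫ r in (0 : ℝ)..s, G r (s - r)) atTop
      (𝓝 (Real.pi * L)) := by
  set A : ℝ → ℝ := fun s => ∫ ρ in (0 : ℝ)..1, s * G (s * ρ) (s * (1 - ρ)) with hA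
  have hAm : StronglyMeasurable A := by
    simp only [hA, intervalIntegral.integral_of_le zero_le_one]
    have hmeas : StronglyMeasurable fun q : ℝ × ℝ => q.1 * G (q.1 * q.2) (q.1 * (1 - q.2)) :=
      measurable_fst.stronglyMeasurable.mul (hG.comp_measurable
        (by fun_prop : Measurable fun q : ℝ × ℝ => (q.1 * q.2, q.1 * (1 - q.2))))
    exact hmeas.integral_prod_right'
  have hAle : ∀ s > 0, ‖A s‖ ≤ C * Real.pi * s ^ (-(0 : ℝ)) := fun s hs => by
    rw [neg_zero, Real.rpow_zero, mul_one, ← integral_inv_sqrt_mul_sqrt,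
      ← intervalIntegral.integral_const_mul]
    exact intervalIntegral.norm_integral_le_of_norm_le zero_le_one
      (by simpa only [Set.uIoc_of_le (zero_le_one (α := ℝ))] using
        ae_uIoc_zero_one_of_forall_Ioo fun ρ hρ => norm_mul_comp_scaling_le hle hs hρ)
      (intervalIntegrable_inv_sqrt_mul_sqrt.const_mul C)
  have hmean := tendsto_rpow_mul_integral zero_lt_one hAm hAle
    (by simpa only [Real.rpow_zero, one_mul] using tendsto_integral_comp_scaling hG hle hlim)
  rw [sub_zero, inv_one, one_mul] at hmean
  refine hmean.congr' ?_
  filter_upwards [eventually_gt_atTop 0] with S hS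
  rw [zero_sub, Real.rpow_neg_one]
  congr 1
  refine intervalIntegral.integral_congr_ae (.of_forall fun s hs => ?_)
  rw [Set.uIoc_of_le hS.le] at hs
  exact (integral_triangle_slice_eq hs.1).symm

end Triangle

theorem integral_prod_self_eq_two_mul {ν : Measure ℝ} [SFinite ν] [NullSingletonClass ν]
    {K : ℝ × ℝ → ℝ} (hK : Integrable K (ν.prod ν)) (hsymm : ∀ p, K p.swap = K p) :
    ∫ p, K p ∂(ν.prod ν) = 2 * ∫ s, ∫ r in Set.Iio s, K (r, s) ∂ν ∂ν := by
  set D : Set (ℝ × ℝ) := {p | p.1 < p.2}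
  have hD : MeasurableSet D := measurableSet_lt measurable_fst measurable_snd
  have hdiag : ∀ᵐ p ∂(ν.prod ν), p.1 ≠ p.2 := by
    refine (Measure.ae_prod_iff_ae_ae (p := fun p : ℝ × ℝ => p.1 ≠ p.2)
      (measurableSet_eq_fun measurable_fst measurable_snd).compl).2 (.of_forall fun x => ?_)
    simp only [ne_comm (a := x)]
    exact Measure.ae_ne ν x
  have hswap : ∫ p in Dᶜ, K p ∂(ν.prod ν) = ∫ p in D, K p ∂(ν.prod ν) := by
    rw [← integral_indicator hD, ← integral_indicator hD.compl, ← integral_prod_swap]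
    refine integral_congr_ae ?_
    filter_upwards [hdiag] with p hp
    by_cases hpD : p.1 < p.2
    · simp [D, hpD, hpD.le, hsymm p]
    · simp [D, hpD, lt_of_le_of_ne (not_lt.1 hpD) hp.symm]
  have hslice : ∫ p in D, K p ∂(ν.prod ν) = ∫ s, ∫ r in Set.Iio s, K (r, s) ∂ν ∂ν := by
    rw [← integral_indicator hD, integral_prod_symm _ (hK.indicator hD)]
    refine integral_congr_ae (.of_forall fun s => ?_)
    simp only [← integral_indicator measurableSet_Iio]
    rfl
  rw [← integral_add_compl hD hK, hswap, hslice, two_mul]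

theorem memLp_top_comp {α β : Type*} [MeasurableSpace α] [MeasurableSpace β] {μ : Measure α}
    {η : Measure β} {f : β → ℝ} {g : α → β} (hf : MemLp f ∞ η) (hg : AEMeasurable g μ)
    (hac : μ.map g ≪ η) : MemLp (fun x => f (g x)) ∞ μ :=
  (memLp_map_measure_iff (hf.1.mono_ac hac) hg).1 <|
    memLp_top_of_bound (hf.1.mono_ac hac) (lpNorm f ∞ η) (hac.ae_le (ae_le_lpNorm_exponent_top hf))

section OccupationMoments

variable {Ω : Type*} [MeasurableSpace Ω] {P : Measure Ω} [IsFiniteMeasure P] {ν : Measure ℝ}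
  [IsFiniteMeasure ν] {Z : ℝ → Ω → ℝ}

theorem ae_integrable_section (hZ : MemLp (Function.uncurry Z) ∞ (ν.prod P)) :
    ∀ᵐ ω ∂P, Integrable (fun s => Z s ω) ν :=
  (hZ.integrable le_top).prod_left_ae

theorem memLp_integral_section (hZ : MemLp (Function.uncurry Z) ∞ (ν.prod P)) :
    MemLp (fun ω => ∫ s, Z s ω ∂ν) ∞ P := by
  have hle := Measure.ae_ae_of_ae_prod
    (Measure.measurePreserving_swap.quasiMeasurePreserving.ae (ae_le_lpNorm_exponent_top hZ))
  refine memLp_top_of_bound hZ.1.prod_swap.integral_prod_right'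
    (lpNorm (Function.uncurry Z) ∞ (ν.prod P) * ν.real Set.univ) ?_
  filter_upwards [hle] with ω hω
  exact norm_integral_le_of_norm_le_const hω

theorem integrable_mul_mul (hZ : MemLp (Function.uncurry Z) ∞ (ν.prod P)) :
    Integrable (fun q : (ℝ × ℝ) × Ω => Z q.1.1 q.2 * Z q.1.2 q.2) ((ν.prod ν).prod P) := by
  have hfst : MemLp (fun q : (ℝ × ℝ) × Ω => Z q.1.1 q.2) ∞ ((ν.prod ν).prod P) :=
    memLp_top_comp hZ (by fun_prop) (QuasiMeasurePreserving.prodMap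
      Measure.quasiMeasurePreserving_fst (.id P)).absolutelyContinuous
  have hsnd : MemLp (fun q : (ℝ × ℝ) × Ω => Z q.1.2 q.2) ∞ ((ν.prod ν).prod P) :=
    memLp_top_comp hZ (by fun_prop) (QuasiMeasurePreserving.prodMap
      Measure.quasiMeasurePreserving_snd (.id P)).absolutelyContinuous
  exact (hsnd.integrable le_top).bdd_mul hfst.1 (ae_le_lpNorm_exponent_top hfst)

theorem integral_sq_integral_section (hZ : MemLp (Function.uncurry Z) ∞ (ν.prod P)) :
    ∫ ω, (∫ s, Z s ω ∂ν) ^ 2 ∂P = ∫ p, ∫ ω, Z p.1 ω * Z p.2 ω ∂P ∂(ν.prod ν) := by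
  simp only [sq, ← integral_prod_mul]
  exact (integral_integral_swap (f := fun (p : ℝ × ℝ) ω => Z p.1 ω * Z p.2 ω)
    (integrable_mul_mul hZ)).symm

theorem integral_sq_integral_section_eq_two_mul [NullSingletonClass ν]
    (hZ : MemLp (Function.uncurry Z) ∞ (ν.prod P)) :
    ∫ ω, (∫ s, Z s ω ∂ν) ^ 2 ∂P = 2 * ∫ s, ∫ r in Set.Iio s, ∫ ω, Z r ω * Z s ω ∂P ∂ν ∂ν := by
  rw [integral_sq_integral_section hZ]
  exact integral_prod_self_eq_two_mul (integrable_mul_mul hZ).integral_prod_left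
    fun p => by simp only [Prod.fst_swap, Prod.snd_swap, mul_comm]

end OccupationMoments

/-! ### Joint measurability and occupation integrals -/

theorem map_prod_absolutelyContinuous {α β γ : Type*} [MeasurableSpace α] [MeasurableSpace β]
    [MeasurableSpace γ] {μ : Measure α} {ν : Measure β} [SFinite ν] {η : Measure γ} {g : α × β → γ}
    (hg : AEMeasurable g (μ.prod ν)) (h : ∀ᵐ x ∂μ, ν.map (fun y => g (x, y)) ≪ η) :
    (μ.prod ν).map g ≪ η := by
  rw [Measure.map_congr hg.ae_eq_mk]
  refine (QuasiMeasurePreserving.prod_of_right hg.measurable_mk ?_).absolutelyContinuous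
  filter_upwards [Measure.ae_ae_of_ae_prod hg.ae_eq_mk, h] with x hx hac
  exact ⟨by fun_prop, by rwa [← Measure.map_congr hx]⟩

/-- The first point of the grid `(n + 1)⁻¹ ℕ` strictly to the right of `s`. -/
noncomputable def rightApprox (n : ℕ) (s : ℝ≥0) : ℝ≥0 := (⌊(n + 1) * s⌋₊ + 1) / (n + 1)

theorem self_le_rightApprox (n : ℕ) (s : ℝ≥0) : s ≤ rightApprox n s := by
  rw [rightApprox, le_div_iff₀ (by positivity), mul_comm]
  exact (Nat.lt_floor_add_one _).le

theorem rightApprox_le_add (n : ℕ) (s : ℝ≥0) : rightApprox n s ≤ s + 1 / (n + 1) := by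
  rw [rightApprox, add_div]
  gcongr
  rw [div_le_iff₀ (by positivity), mul_comm s]
  exact Nat.floor_le (by positivity)

theorem tendsto_rightApprox (s : ℝ≥0) :
    Tendsto (fun n => rightApprox n s) atTop (𝓝[≥] s) := by
  have hupper : Tendsto (fun n : ℕ => s + 1 / ((n : ℝ≥0) + 1)) atTop (𝓝 s) := by
    simpa only [add_zero] using
      tendsto_const_nhds.add (tendsto_one_div_add_atTop_nhds_zero_nat (𝕜 := ℝ≥0))
  exact tendsto_nhdsWithin_iff.2 ⟨tendsto_of_tendsto_of_tendsto_of_le_of_le tendsto_const_nhds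
    hupper (self_le_rightApprox · s) (rightApprox_le_add · s),
    .of_forall fun n => self_le_rightApprox n s⟩

section LevyPaths

variable {Ω : Type*} [MeasurableSpace Ω] {P : Measure Ω} {X : ℝ≥0 → Ω → ℝ}

theorem measurable_comp_rightApprox (hX : ∀ t, Measurable (X t)) (n : ℕ) :
    Measurable fun p : ℝ≥0 × Ω => X (rightApprox n p.1) p.2 := by
  have hgrid : Measurable fun q : ℕ × Ω => X ((q.1 + 1) / (n + 1)) q.2 :=
    measurable_from_prod_countable_right (f := fun q : ℕ × Ω => X ((q.1 + 1) / (n + 1)) q.2)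
      fun k => hX ((k + 1) / (n + 1))
  have hfloor : Measurable fun p : ℝ≥0 × Ω => ⌊((n : ℝ≥0) + 1) * p.1⌋₊ :=
    Nat.measurable_floor.comp (by fun_prop)
  simpa only [rightApprox, Function.comp_def] using hgrid.comp (hfloor.prodMk measurable_snd)

theorem IsLevyProcess.aemeasurable_toNNReal (hX : IsLevyProcess X P) (ν : Measure ℝ) :
    AEMeasurable (fun p : ℝ × Ω => X p.1.toNNReal p.2) (ν.prod P) := by
  refine aemeasurable_of_tendsto_metrizable_ae atTop (fun n =>
    ((measurable_comp_rightApprox hX.measurable n).comp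
      (by fun_prop : Measurable fun p : ℝ × Ω => (p.1.toNNReal, p.2))).aemeasurable) ?_
  filter_upwards [Measure.quasiMeasurePreserving_snd.ae hX.cadlag] with p hp
  exact (hp p.1.toNNReal).1.tendsto.comp (tendsto_rightApprox p.1.toNNReal)

section Marginals

variable {Ψ : ℝ → ℝ} {ℓ : ℝ} {f : ℝ → ℝ}

theorem HasCharExponent.charFun_map (hΨ : HasCharExponent X P Ψ) {s : ℝ≥0}
    (hX : AEMeasurable (X s) P) (x : ℝ) :
    charFun (P.map (X s)) x = (Real.exp (-s * Ψ x) : ℝ) := by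
  have hneg : charFun (P.map (X s)) (-x) = (Real.exp (-s * Ψ x) : ℝ) := by
    push_cast
    rw [charFun_apply_real, integral_map hX (by fun_prop), ← hΨ s x]
    congr! 3
    push_cast
    ring
  rw [← neg_neg x, charFun_neg, hneg, Complex.conj_ofReal, neg_neg]

variable [IsProbabilityMeasure P]

theorem HasCharExponent.isRegularExponent (hΨ : HasCharExponent X P Ψ)
    (hX : ∀ s, AEMeasurable (X s) P) (hℓ : 0 < ℓ)
    (hzero : Tendsto (fun x => Ψ x / x ^ 2) (𝓝[>] 0) (𝓝 ℓ))
    (hinfty : Tendsto (fun x => Ψ x / Real.log (|x| + 1)) atTop atTop) :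
    IsRegularExponent Ψ ℓ where
  exists_law s hs := ⟨P.map (X s.toNNReal), Measure.isProbabilityMeasure_map (hX _), fun x => by
    rw [hΨ.charFun_map (hX _), Real.coe_toNNReal s hs.le]⟩
  ell_pos := hℓ
  tendsto_zero := hzero
  tendsto_infty := hinfty

theorem HasCharExponent.map_absolutelyContinuous (hΨ : HasCharExponent X P Ψ)
    (h : IsRegularExponent Ψ ℓ) {s : ℝ≥0} (hX : AEMeasurable (X s) P) (hs : 0 < s) :
    P.map (X s) ≪ volume := by
  have := Measure.isProbabilityMeasure_map hX
  rw [h.eq_withDensity_density (NNReal.coe_pos.2 hs) (hΨ.charFun_map hX)]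
  exact withDensity_absolutelyContinuous _ _

theorem HasCharExponent.integral_comp (hΨ : HasCharExponent X P Ψ) (h : IsRegularExponent Ψ ℓ)
    {s : ℝ≥0} (hX : AEMeasurable (X s) P) (hs : 0 < s) (hf : AEStronglyMeasurable f) :
    ∫ ω, f (X s ω) ∂P = transition Ψ s f 0 := by
  have := Measure.isProbabilityMeasure_map hX
  rw [← integral_map hX (hf.mono_ac (hΨ.map_absolutelyContinuous h hX hs)),
    h.integral_eq_density_mul (NNReal.coe_pos.2 hs) (hΨ.charFun_map hX)]
  simp only [transition, zero_add]

theorem IsLevyProcess.map_prodMk_increment (hX : IsLevyProcess X P) (r u : ℝ≥0) :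
    P.map (fun ω => (X r ω, X (r + u) ω - X r ω)) = (P.map (X r)).prod (P.map (X u)) := by
  have hind : IndepFun (X r) (fun ω => X (r + u) ω - X r ω) P := by
    refine (hX.indep_increments.indepFun_sub_sub zero_le (le_add_of_nonneg_right zero_le)).congr
      ?_ .rfl
    filter_upwards [hX.start_zero] with ω hω
    simp [hω]
  rw [← (hX.stationary_increments r u).map_eq]
  exact (indepFun_iff_map_prod_eq_prod_map_map (hX.measurable r).aemeasurable
    ((hX.measurable _).sub (hX.measurable r)).aemeasurable).1 hind

theorem memLp_mul_comp_add (hf : MemLp f ∞) :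
    MemLp (fun p : ℝ × ℝ => f p.1 * f (p.1 + p.2)) ∞ (volume.prod volume) :=
  (memLp_top_comp hf (by fun_prop) (Measure.quasiMeasurePreserving_snd.comp
    (measurePreserving_prod_add volume volume).quasiMeasurePreserving).absolutelyContinuous).mul
  (memLp_top_comp hf (by fun_prop) Measure.quasiMeasurePreserving_fst.absolutelyContinuous)

theorem IsLevyProcess.integral_comp_mul_comp_add (hX : IsLevyProcess X P)
    (hΨ : HasCharExponent X P Ψ) (h : IsRegularExponent Ψ ℓ) (hf : MemLp f ∞)
    {r u : ℝ≥0} (hr : 0 < r) (hu : 0 < u) :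
    ∫ ω, f (X r ω) * f (X (r + u) ω) ∂P = twoTimeMean Ψ f r u := by
  have hXm (s : ℝ≥0) : AEMeasurable (X s) P := (hX.measurable s).aemeasurable
  have := Measure.isProbabilityMeasure_map (hXm r)
  have := Measure.isProbabilityMeasure_map (hXm u)
  have hac : (P.map (X r)).prod (P.map (X u)) ≪ volume.prod volume :=
    (hΨ.map_absolutelyContinuous h (hXm r) hr).prod (hΨ.map_absolutelyContinuous h (hXm u) hu)
  have hmem : MemLp (fun p : ℝ × ℝ => f p.1 * f (p.1 + p.2)) ∞
      ((P.map (X r)).prod (P.map (X u))) :=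
    memLp_top_comp (memLp_mul_comp_add hf) aemeasurable_id (by rwa [Measure.map_id'])
  calc ∫ ω, f (X r ω) * f (X (r + u) ω) ∂P
      = ∫ p, f p.1 * f (p.1 + p.2) ∂((P.map (X r)).prod (P.map (X u))) := by
        rw [← hX.map_prodMk_increment r u, integral_map (by fun_prop)
          (by simpa only [hX.map_prodMk_increment r u] using hmem.1)]
        simp only [add_sub_cancel]
    _ = ∫ x, f x * ∫ y, f (x + y) ∂(P.map (X u)) ∂(P.map (X r)) := by
        rw [integral_prod _ (hmem.integrable le_top)]
        simp only [integral_const_mul]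
    _ = twoTimeMean Ψ f r u := by
        simp only [h.integral_eq_density_mul (NNReal.coe_pos.2 hr) (hΨ.charFun_map (hXm r)),
          h.integral_eq_density_mul (NNReal.coe_pos.2 hu) (hΨ.charFun_map (hXm u)),
          twoTimeMean, transition]

end Marginals

section OccupationIntegral

variable [IsProbabilityMeasure P] {Ψ : ℝ → ℝ} {ℓ S : ℝ} {f : ℝ → ℝ}

theorem IsLevyProcess.memLp_comp (hX : IsLevyProcess X P) (hΨ : HasCharExponent X P Ψ)
    (h : IsRegularExponent Ψ ℓ) (hf : MemLp f ∞) (S : ℝ) :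
    MemLp (Function.uncurry fun s ω => f (X s.toNNReal ω)) ∞
      ((volume.restrict (Set.Ioc 0 S)).prod P) := by
  have hmeas := hX.aemeasurable_toNNReal (volume.restrict (Set.Ioc 0 S))
  refine memLp_top_comp (g := fun p : ℝ × Ω => X p.1.toNNReal p.2) hf hmeas <|
    map_prod_absolutelyContinuous hmeas ?_
  filter_upwards [ae_restrict_mem measurableSet_Ioc] with s hs
  exact hΨ.map_absolutelyContinuous h (hX.measurable _).aemeasurable (Real.toNNReal_pos.2 hs.1)

theorem IsLevyProcess.integral_integral_comp (hX : IsLevyProcess X P)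
    (hΨ : HasCharExponent X P Ψ) (h : IsRegularExponent Ψ ℓ) (hf : MemLp f ∞) (hS : 0 ≤ S) :
    ∫ ω, (∫ s in (0 : ℝ)..S, f (X s.toNNReal ω)) ∂P = ∫ s in (0 : ℝ)..S, transition Ψ s f 0 := by
  simp only [intervalIntegral.integral_of_le hS]
  rw [← integral_integral_swap ((hX.memLp_comp hΨ h hf S).integrable le_top)]
  refine setIntegral_congr_fun measurableSet_Ioc fun s hs => ?_
  simp only [hΨ.integral_comp h (hX.measurable _).aemeasurable (Real.toNNReal_pos.2 hs.1) hf.1,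
    Real.coe_toNNReal s hs.1.le]

theorem IsLevyProcess.integral_sq_integral_comp (hX : IsLevyProcess X P)
    (hΨ : HasCharExponent X P Ψ) (h : IsRegularExponent Ψ ℓ) (hf : MemLp f ∞) (hS : 0 ≤ S) :
    ∫ ω, (∫ s in (0 : ℝ)..S, f (X s.toNNReal ω)) ^ 2 ∂P
      = 2 * ∫ s in (0 : ℝ)..S, ∫ r in (0 : ℝ)..s, twoTimeMean Ψ f r (s - r) := by
  simp only [intervalIntegral.integral_of_le hS]
  rw [integral_sq_integral_section_eq_two_mul (hX.memLp_comp hΨ h hf S)]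
  congr 1
  refine setIntegral_congr_fun measurableSet_Ioc fun s hs => ?_
  have hset : Set.Iio s ∩ Set.Ioc 0 S = Set.Ioo 0 s := by
    ext r
    simp only [Set.mem_inter_iff, Set.mem_Iio, Set.mem_Ioc, Set.mem_Ioo]
    exact ⟨fun hr => ⟨hr.2.1, hr.1⟩, fun hr => ⟨hr.2, hr.1, (hr.2.trans_le hs.2).le⟩⟩
  simp only [intervalIntegral.integral_of_le hs.1.le, integral_Ioc_eq_integral_Ioo,
    Measure.restrict_restrict measurableSet_Iio, hset]
  refine setIntegral_congr_fun measurableSet_Ioo fun r hr => ?_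
  have hsr : 0 < s - r := sub_pos.2 hr.2
  have := hX.integral_comp_mul_comp_add hΨ h hf (Real.toNNReal_pos.2 hr.1)
    (Real.toNNReal_pos.2 hsr)
  rwa [← Real.toNNReal_add hr.1.le hsr.le, add_sub_cancel, Real.coe_toNNReal r hr.1.le,
    Real.coe_toNNReal _ hsr.le] at this

theorem IsLevyProcess.tendsto_integral_integral_comp (hX : IsLevyProcess X P)
    (hΨ : HasCharExponent X P Ψ) (h : IsRegularExponent Ψ ℓ) (hf : Integrable f)
    (hf' : MemLp f ∞) :
    Tendsto (fun S => (√S)⁻¹ * ∫ ω, (∫ s in (0 : ℝ)..S, f (X s.toNNReal ω)) ∂P) atTop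
      (𝓝 (2 * (heatConst ℓ * ∫ x, f x))) := by
  obtain ⟨C, -, hC⟩ := h.exists_transition_norm_le hf hf'
  have hmeas : StronglyMeasurable fun s => transition Ψ s f 0 :=
    (h.stronglyMeasurable_transition hf.1).comp_measurable
      (by fun_prop : Measurable fun s : ℝ => (s, (0 : ℝ)))
  have hle : ∀ s > 0, ‖transition Ψ s f 0‖ ≤ C * s ^ (-(1 / 2 : ℝ)) := fun s hs => by
    rw [Real.rpow_neg hs.le, ← Real.sqrt_eq_rpow]
    exact (h.norm_transition_le hs 0).trans (hC s hs 0)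
  have hlim := tendsto_rpow_mul_integral (by norm_num) hmeas hle
    (by simpa only [Real.sqrt_eq_rpow] using h.tendsto_sqrt_mul_transition hf 0)
  rw [show (1 / 2 - 1 : ℝ) = -(1 / 2) by norm_num, show (1 - 1 / 2 : ℝ)⁻¹ = 2 by norm_num] at hlim
  refine hlim.congr' ?_
  filter_upwards [eventually_ge_atTop 0] with S hS
  rw [hX.integral_integral_comp hΨ h hf' hS, Real.rpow_neg hS, ← Real.sqrt_eq_rpow]

theorem IsLevyProcess.tendsto_integral_sq_integral_comp (hX : IsLevyProcess X P)
    (hΨ : HasCharExponent X P Ψ) (h : IsRegularExponent Ψ ℓ) (hf : Integrable f)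
    (hf' : MemLp f ∞) :
    Tendsto (fun S => S⁻¹ * ∫ ω, (∫ s in (0 : ℝ)..S, f (X s.toNNReal ω)) ^ 2 ∂P) atTop
      (𝓝 (2 * (Real.pi * (heatConst ℓ * ∫ x, f x) ^ 2))) := by
  obtain ⟨C, hC⟩ := h.exists_norm_twoTimeMean_le hf hf'
  refine ((tendsto_inv_mul_integral_triangle (h.stronglyMeasurable_twoTimeMean hf.1) hC
    (h.tendsto_sqrt_mul_twoTimeMean hf hf')).const_mul 2).congr' ?_
  filter_upwards [eventually_ge_atTop 0] with S hS
  rw [hX.integral_sq_integral_comp hΨ h hf' hS]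
  ring

end OccupationIntegral

end LevyPaths

end LevyFunctional

theorem corollary1p1_general {Ω : Type*} [MeasurableSpace Ω] {P : Measure Ω}
    [IsProbabilityMeasure P] {X : ℝ≥0 → Ω → ℝ} (hX : LevyFunctional.IsLevyProcess X P) {Ψ : ℝ → ℝ}
    (hΨ : LevyFunctional.HasCharExponent X P Ψ) {ℓ : ℝ} (hℓ : 0 < ℓ)
    (hzero : Tendsto (fun x => Ψ x / x ^ 2) (𝓝[>] 0) (𝓝 ℓ))
    (hinfty : Tendsto (fun x => Ψ x / Real.log (|x| + 1)) atTop atTop) {f : ℝ → ℝ}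
    (hf : Integrable f) (hf' : MemLp f ∞) {t : ℝ} (ht : 0 < t) :
    (∀ c > 0, ∀ᵐ ω ∂P, IntervalIntegrable (fun s : ℝ => f (X s.toNNReal ω)) volume
        0 (t ^ 2 * c ^ 2)) ∧
    (∀ c > 0, MemLp (LevyFunctional.additiveFunctional X f c t) ∞ P) ∧
    Tendsto (fun c => ∫ ω, LevyFunctional.additiveFunctional X f c t ω ∂P) atTop
      (𝓝 ((∫ x, f x) * (t / √(Real.pi * ℓ)))) ∧
    Tendsto (fun c => ∫ ω, LevyFunctional.additiveFunctional X f c t ω ^ 2 ∂P) atTop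
      (𝓝 ((∫ x, f x) ^ 2 * (t ^ 2 / (2 * ℓ)))) := by
  have h := hΨ.isRegularExponent (fun s => (hX.measurable s).aemeasurable) hℓ hzero hinfty
  have hZ (c : ℝ) := hX.memLp_comp hΨ h hf' (t ^ 2 * c ^ 2)
  have hT (c : ℝ) : 0 ≤ t ^ 2 * c ^ 2 := by positivity
  have hlim : Tendsto (fun c : ℝ => t ^ 2 * c ^ 2) atTop atTop :=
    (tendsto_pow_atTop two_ne_zero).const_mul_atTop (by positivity)
  refine ⟨fun c _ => ?_, fun c _ => ?_, ?_, ?_⟩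
  · simpa only [intervalIntegrable_iff_integrableOn_Ioc_of_le (hT c), IntegrableOn] using
      LevyFunctional.ae_integrable_section (hZ c)
  · unfold LevyFunctional.additiveFunctional
    simpa only [intervalIntegral.integral_of_le (hT c)] using
      (LevyFunctional.memLp_integral_section (hZ c)).const_mul c⁻¹
  · have hmean := ((hX.tendsto_integral_integral_comp hΨ h hf hf').comp hlim).const_mul t
    convert hmean.congr' ?_ using 2
    · rw [LevyFunctional.heatConst]
      ring
    filter_upwards [eventually_gt_atTop 0] with c hc
    rw [Function.comp_apply, ← mul_pow, Real.sqrt_sq (by positivity)]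
    simp only [LevyFunctional.additiveFunctional, integral_const_mul, mul_pow]
    field_simp
  · have hmean := ((hX.tendsto_integral_sq_integral_comp hΨ h hf hf').comp hlim).const_mul (t ^ 2)
    convert hmean.congr' ?_ using 2
    · rw [LevyFunctional.heatConst, mul_pow, inv_pow, mul_pow, Real.sq_sqrt (by positivity)]
      field_simp
    filter_upwards [eventually_gt_atTop 0] with c hc
    rw [Function.comp_apply]
    simp only [LevyFunctional.additiveFunctional, mul_pow, integral_const_mul]
    field_simp

theorem corollary1p1 {Ω : Type*} [MeasurableSpace Ω] (P : Measure Ω) [IsProbabilityMeasure P]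
    (X : ℝ≥0 → Ω → ℝ) (hX : LevyFunctional.IsLevyProcess X P)
    (hsymm : LevyFunctional.IsSymmetricProcess X P)
    (Ψ : ℝ → ℝ) (hΨ : LevyFunctional.HasCharExponent X P Ψ)
    (ℓ : ℝ) (hadm : LevyFunctional.IsAdmissibleExponent Ψ ℓ)
    (f : ℝ → ℝ) (hf : LevyFunctional.IsAdmissibleFunction f)
    (a : ℕ → ℝ) (ha_pos : ∀ n, 0 < a n) (ha_mono : Monotone a) (ha_lim : Tendsto a atTop atTop)
    (t : ℝ) (ht : 0 < t) :
    (∀ n, ∀ᵐ ω ∂P, IntervalIntegrable (fun s : ℝ => f (X s.toNNReal ω)) volume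
        0 (t ^ 2 * a n ^ 2)) ∧
    (∀ n, MemLp (LevyFunctional.additiveFunctional X f (a n) t) 2 P) ∧
    Tendsto (fun n => ∫ ω, LevyFunctional.additiveFunctional X f (a n) t ω ∂P) atTop
      (𝓝 ((∫ x, f x) * (t / Real.sqrt (Real.pi * ℓ)))) ∧
    Tendsto (fun n => ∫ ω, (LevyFunctional.additiveFunctional X f (a n) t ω) ^ 2 ∂P) atTop
      (𝓝 ((∫ x, f x) ^ 2 * (t ^ 2 / (2 * ℓ)))) := by
  obtain ⟨hint, hmem, hmean, hsq⟩ := corollary1p1_general hX hΨ hadm.ell_pos hadm.tendsto_zero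
    hadm.tendsto_infty hf.integrable hf.essBounded ht
  exact ⟨fun n => hint _ (ha_pos n), fun n => (hmem _ (ha_pos n)).mono_exponent le_top,
    hmean.comp ha_lim, hsq.comp ha_lim⟩
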